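/- For complex $x$ and an integer $n\ge 0$ let $(x)_n=x(x+1)\cdots(x+n-1)$ (with $(x)_0=1$), and for complex $k$ let $(x)_k=\Gamma(x+k)/\Gamma(x)$. Then for every $k\in\mathbb{C}$ with $2k\notin\{-1,-2,-3,\dots\}$ the following two series converge absolutely and $$\sum_{n=0}^{\infty}\Big(\frac14\Big)^n\frac{(\frac12-k)_n(\frac12+k)_n(\frac12+3k)_n}{(1+k)_n(1+2k)_n(1)_n}(6n+6k+1)=\frac4\pi\Big(\frac{16}{27}\Big)^k\frac{(1)_k^2}{(\frac16)_k(\frac56)_k},$$ $$\sum_{n=0}^{\infty}\Big(\frac{-1}8\Big)^n\frac{(\frac12-k)_n(\frac12+k)_n(\frac12+3k)_n}{(1+k)_n(1+2k)_n(1)_n}(6n+6k+1)=\frac{2\sqrt2}\pi\Big(\frac{32}{27}\Big)^k\frac{(1)_k^2}{(\frac16)_k(\frac56)_k},$$ where the right-hand sides are read as $0$ at the values of $k$ at which $(\frac16)_k$ or $(\frac56)_k$ has a pole. In particular ($k=0$), $$\sum_{n=0}^{\infty}\Big(\frac14\Big)^n\frac{(\frac12)_n^3}{(1)_n^3}(6n+1)=\frac4\pi,\qquad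 \sum_{n=0}^{\infty}\Big(\frac{-1}8\Big)^n\frac{(\frac12)_n^3}{(1)_n^3}(6n+1)=\frac{2\sqrt2}\pi .$$ -/

import Mathlib

/-- The rising factorial `(x)_n = x (x + 1) ⋯ (x + n - 1)` for a natural number `n`. -/
noncomputable def risingNat (x : ℂ) (n : ℕ) : ℂ := (ascPochhammer ℂ n).eval x

/-- The generalized rising factorial `(x)_k = Γ(x + k) / Γ(x)` for complex `k`. -/
noncomputable def risingGamma (x k : ℂ) : ℂ := Complex.Gamma (x + k) / Complex.Gamma x

/-- The `n`-th summand
`z^n (1/2 - k)_n (1/2 + k)_n (1/2 + 3k)_n / ((1 + k)_n (1 + 2k)_n (1)_n) (6n + 6k + 1)`. -/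
noncomputable def ramanujanTerm (z k : ℂ) (n : ℕ) : ℂ :=
  z ^ n * (risingNat (1 / 2 - k) n * risingNat (1 / 2 + k) n * risingNat (1 / 2 + 3 * k) n /
    (risingNat (1 + k) n * risingNat (1 + 2 * k) n * risingNat 1 n)) * (6 * n + 6 * k + 1)

open Filter Topology

/-! Write S(k) for either sum. A telescoping certificate in n gives (1/6+k)(5/6+k) S(k+1) = b(1+k)²
S(k), with b = 16/27 or 32/27, and `gammaSide` obeys the same recurrence. Hence their quotient has
period 1 on Re k > 0. A termwise majorant for S and a Beta integral for the Gamma factors bound this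
quotient by C exp(π|Im k|) on 0 < Re k ≤ 1. In q = exp(2πik) that is growth |q|^(±1/2), too slow for
a pole at 0 or for a nonconstant entire function, so the quotient is constant
(`eq_of_periodic_of_norm_le_exp`). At k = 1/2 the series reduces to its first term, 4, which fixes
the constant (`tsum_mul_gammaWeight_eq`). The recurrence, solved for S(k), carries the identity
leftwards to all admissible k (`tsum_ramanujanTerm_eq_gammaSide`). -/

theorem risingNat_zero (x : ℂ) : risingNat x 0 = 1 := by simp [risingNat]

theorem risingNat_succ (x : ℂ) (n : ℕ) : risingNat x (n + 1) = risingNat x n * (x + n) := by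
  simp [risingNat, ascPochhammer_succ_eval]

theorem mul_risingNat_add_one (x : ℂ) (n : ℕ) :
    x * risingNat (x + 1) n = risingNat x n * (x + n) := by
  induction n with
  | zero => simp [risingNat_zero]
  | succ n ih =>
    rw [risingNat_succ, risingNat_succ, ← mul_assoc, ih]
    push_cast
    ring

theorem risingNat_ne_zero {x : ℂ} (hx : ∀ m : ℕ, x + m ≠ 0) (n : ℕ) : risingNat x n ≠ 0 := by
  induction n with
  | zero => simp [risingNat_zero]
  | succ n ih => rw [risingNat_succ]; exact mul_ne_zero ih (hx n)

theorem risingNat_one_ne_zero (n : ℕ) : risingNat 1 n ≠ 0 :=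
  risingNat_ne_zero (fun m => by rw [add_comm]; exact_mod_cast m.succ_ne_zero) n

/-- The exponents `k` at which no denominator of the series vanishes. -/
def Admissible (k : ℂ) : Prop := ∀ m : ℕ, 2 * k ≠ -((m : ℂ) + 1)

namespace Admissible

variable {k : ℂ}

theorem one_add_two_mul_add_ne_zero (hk : Admissible k) (m : ℕ) : 1 + 2 * k + m ≠ 0 :=
  fun h => hk m (by linear_combination h)

theorem one_add_add_ne_zero (hk : Admissible k) (m : ℕ) : 1 + k + m ≠ 0 :=
  fun h => hk (2 * m + 1) (by push_cast; linear_combination 2 * h)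

theorem two_add_two_mul_add_ne_zero (hk : Admissible k) (m : ℕ) : 2 + 2 * k + m ≠ 0 :=
  fun h => hk (m + 1) (by push_cast; linear_combination h)

theorem half_add_ne_zero (hk : Admissible k) : 1 / 2 + k ≠ 0 :=
  fun h => hk 0 (by push_cast; linear_combination 2 * h)

theorem one_add_ne_zero (hk : Admissible k) : 1 + k ≠ 0 := by
  simpa using hk.one_add_add_ne_zero 0

theorem add_one (hk : Admissible k) : Admissible (k + 1) :=
  fun m h => hk (m + 2) (by push_cast; linear_combination h)

theorem of_re_pos (hk : 0 < k.re) : Admissible k := fun m h => by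
  have := congrArg Complex.re h
  simp at this
  have : (0 : ℝ) ≤ m := m.cast_nonneg
  linarith

end Admissible

/-! ### Telescoping certificates for the shift of k -/

/-- The hypergeometric factor common to the summands at `k` and at `k + 1`. -/
noncomputable def sharedFactor (z k : ℂ) (n : ℕ) : ℂ :=
  z ^ n * (risingNat (-1 / 2 - k) n * risingNat (1 / 2 + k) n * risingNat (1 / 2 + 3 * k) n /
    (risingNat (1 + k) n * risingNat (1 + 2 * k) n * risingNat 1 n))

theorem sharedFactor_succ {z k : ℂ} (hk : Admissible k) (n : ℕ) :
    sharedFactor z k (n + 1) = z * ((-1 / 2 - k + n) * (1 / 2 + k + n) * (1 / 2 + 3 * k + n) /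
      ((1 + k + n) * (1 + 2 * k + n) * (1 + n))) * sharedFactor z k n := by
  have h1 := hk.one_add_add_ne_zero n
  have h2 := hk.one_add_two_mul_add_ne_zero n
  have h3 : (1 + n : ℂ) ≠ 0 := by rw [add_comm]; exact_mod_cast n.succ_ne_zero
  simp only [sharedFactor, risingNat_succ, pow_succ]
  rw [mul_mul_mul_comm z, ← mul_assoc, mul_comm z]
  simp only [div_eq_mul_inv, mul_inv]
  ring

/-- The parameter 1/2 - k drops to -1/2 - k under k ↦ k + 1. The shared factor uses the lower value,
and returning to 1/2 - k costs one rational factor. -/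
theorem ramanujanTerm_eq_sharedFactor_mul {z k : ℂ} (hk : Admissible k) (n : ℕ) :
    ramanujanTerm z k n =
      sharedFactor z k n * (-(n - 1 / 2 - k) * (6 * n + 6 * k + 1) / (1 / 2 + k)) := by
  have h0 := hk.half_add_ne_zero
  have hA : risingNat (1 / 2 - k) n = risingNat (-1 / 2 - k) n * (-(n - 1 / 2 - k) / (1 / 2 + k)) := by
    have h := mul_risingNat_add_one (-1 / 2 - k) n
    rw [show -1 / 2 - k + 1 = 1 / 2 - k by ring] at h
    rw [mul_div_assoc', eq_div_iff h0]
    linear_combination -h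
  rw [ramanujanTerm, hA, sharedFactor]
  simp only [div_eq_mul_inv]
  ring

theorem shift_quotient_eq {a c d₁ d₂ d₃ e D E F : ℂ} (Z A B C u v w y t : ℂ) (ha : a ≠ 0)
    (h1 : d₁ ≠ 0) (h2 : d₂ ≠ 0) (h3 : d₃ ≠ 0) (hc : c ≠ 0) (hD : D ≠ 0)
    (hE : E ≠ 0) (hF : F ≠ 0) (hae : e = 2 * a) :
    Z * (A * (B * u / a) * (C * (v * w * y) / (27 * a)) /
        (D * d₁ / c * (E * d₂ * d₃ / (e * (2 * c))) * F)) * t =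
      Z * (A * B * C / (D * E * F)) * (4 * c ^ 2 / 27 * (u * v * w * y * t) /
        (a * (d₁ * d₂ * d₃))) := by
  subst hae
  field_simp
  ring

/-- Since (1/2+3k)(3/2+3k)(5/2+3k) = 27(1/6+k)(1/2+k)(5/6+k), the prefactor on the left cancels the
zeros at k = -1/6 and -5/6 that shifting (1/2+3k)_n would put in the denominator. -/
theorem mul_ramanujanTerm_add_one {z k : ℂ} (hk : Admissible k) (n : ℕ) :
    (1 / 6 + k) * (5 / 6 + k) * ramanujanTerm z (k + 1) n =
      sharedFactor z k n * (4 * (1 + k) ^ 2 / 27 * ((1 / 2 + k + n) * (1 / 2 + 3 * k + n) *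
        (3 / 2 + 3 * k + n) * (5 / 2 + 3 * k + n) * (6 * n + 6 * k + 7)) /
        ((1 / 2 + k) * ((1 + k + n) * (1 + 2 * k + n) * (2 + 2 * k + n)))) := by
  have h0 := hk.half_add_ne_zero
  have h1 := hk.one_add_add_ne_zero n
  have h2 := hk.one_add_two_mul_add_ne_zero n
  have h3 := hk.two_add_two_mul_add_ne_zero n
  have h4 := hk.one_add_ne_zero
  have h5 : 1 + 2 * k ≠ 0 := by simpa using hk.one_add_two_mul_add_ne_zero 0
  have h6 := risingNat_ne_zero hk.one_add_add_ne_zero n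
  have h7 := risingNat_ne_zero hk.one_add_two_mul_add_ne_zero n
  have h8 := risingNat_one_ne_zero n
  have hB : risingNat (1 / 2 + (k + 1)) n =
      risingNat (1 / 2 + k) n * (1 / 2 + k + n) / (1 / 2 + k) := by
    rw [eq_div_iff h0, ← mul_risingNat_add_one, add_assoc, mul_comm]
  have hC : (1 / 6 + k) * (5 / 6 + k) * risingNat (1 / 2 + 3 * (k + 1)) n =
      risingNat (1 / 2 + 3 * k) n * ((1 / 2 + 3 * k + n) * (3 / 2 + 3 * k + n) *
        (5 / 2 + 3 * k + n)) / (27 * (1 / 2 + k)) := by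
    have e1 := mul_risingNat_add_one (1 / 2 + 3 * k) n
    have e2 := mul_risingNat_add_one (1 / 2 + 3 * k + 1) n
    have e3 := mul_risingNat_add_one (1 / 2 + 3 * k + 1 + 1) n
    rw [show 1 / 2 + 3 * k + 1 + 1 + 1 = 1 / 2 + 3 * (k + 1) by ring] at e3
    rw [eq_div_iff (by simpa using h0)]
    linear_combination (1 / 2 + 3 * k) * (1 / 2 + 3 * k + 1) * e3 +
      (1 / 2 + 3 * k) * (1 / 2 + 3 * k + 1 + 1 + n) * e2 +
      (1 / 2 + 3 * k + 1 + n) * (1 / 2 + 3 * k + 1 + 1 + n) * e1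
  have hD : risingNat (1 + (k + 1)) n = risingNat (1 + k) n * (1 + k + n) / (1 + k) := by
    rw [eq_div_iff h4, ← mul_risingNat_add_one, add_assoc, mul_comm]
  have hE : risingNat (1 + 2 * (k + 1)) n = risingNat (1 + 2 * k) n * (1 + 2 * k + n) *
      (2 + 2 * k + n) / ((1 + 2 * k) * (2 * (1 + k))) := by
    have e1 := mul_risingNat_add_one (1 + 2 * k) n
    have e2 := mul_risingNat_add_one (1 + 2 * k + 1) n
    rw [show 1 + 2 * k + 1 + 1 = 1 + 2 * (k + 1) by ring] at e2
    rw [eq_div_iff (by simp [h4, h5])]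
    linear_combination (1 + 2 * k) * e2 + (1 + 2 * k + 1 + n) * e1
  have hT : (1 / 6 + k) * (5 / 6 + k) * ramanujanTerm z (k + 1) n =
      z ^ n * (risingNat (-1 / 2 - k) n * risingNat (1 / 2 + (k + 1)) n *
        ((1 / 6 + k) * (5 / 6 + k) * risingNat (1 / 2 + 3 * (k + 1)) n) /
        (risingNat (1 + (k + 1)) n * risingNat (1 + 2 * (k + 1)) n * risingNat 1 n)) *
        (6 * n + 6 * k + 7) := by
    rw [ramanujanTerm, show 1 / 2 - (k + 1) = -1 / 2 - k by ring]
    ring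
  rw [hT, hB, hC, hD, hE, sharedFactor]
  have h9 : 1 + 2 * k = 2 * (1 / 2 + k) := by ring
  exact shift_quotient_eq (z ^ n) _ _ _ _ _ _ _ _ h0 h1 h2 h3 h4 h6 h7 h8 h9

/-- A telescoping certificate for the shift `k ↦ k + 1`, with polynomial part `p`. -/
noncomputable def certificate (p : ℂ → ℂ → ℂ) (z k : ℂ) (n : ℕ) : ℂ :=
  sharedFactor z k n * (-(4 * (1 + k) ^ 2 / 27) * (n * p k n / ((1 / 2 + k) * (1 + 2 * k + n))))

/-- Divided by the shared factor, both sides are rational in n and k, so the claim is a polynomial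
identity once denominators are cleared. -/
theorem telescope_quarter {k : ℂ} (hk : Admissible k) (n : ℕ) :
    (1 / 6 + k) * (5 / 6 + k) * ramanujanTerm (1 / 4) (k + 1) n -
        16 / 27 * (1 + k) ^ 2 * ramanujanTerm (1 / 4) k n =
      certificate (fun k n => 40 * n ^ 2 + (40 + 128 * k) * n + (2 + 48 * k + 88 * k ^ 2))
        (1 / 4) k (n + 1) -
      certificate (fun k n => 40 * n ^ 2 + (40 + 128 * k) * n + (2 + 48 * k + 88 * k ^ 2))
        (1 / 4) k n := by
  have h0 := hk.half_add_ne_zero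
  have h1 := hk.one_add_add_ne_zero n
  have h2 := hk.one_add_two_mul_add_ne_zero n
  have h3 := hk.two_add_two_mul_add_ne_zero n
  have h4 : (1 + n : ℂ) ≠ 0 := by rw [add_comm]; exact_mod_cast n.succ_ne_zero
  rw [mul_ramanujanTerm_add_one hk, ramanujanTerm_eq_sharedFactor_mul hk, certificate,
    certificate, sharedFactor_succ hk]
  push_cast
  rw [show 1 + 2 * k + ((n : ℂ) + 1) = 2 + 2 * k + n by ring]
  generalize sharedFactor (1 / 4) k n = s
  generalize (n : ℂ) = x at *
  -- Naming the linear denominators makes them atoms for `field_simp`; they are expanded again for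
  -- `ring`.
  obtain ⟨a, ha⟩ : ∃ a, a = 1 / 2 + k := ⟨_, rfl⟩
  obtain ⟨b, hb⟩ : ∃ b, b = 1 + k + x := ⟨_, rfl⟩
  obtain ⟨c, hc⟩ : ∃ c, c = 1 + 2 * k + x := ⟨_, rfl⟩
  obtain ⟨d, hd⟩ : ∃ d, d = 2 + 2 * k + x := ⟨_, rfl⟩
  obtain ⟨e, he⟩ : ∃ e, e = 1 + x := ⟨_, rfl⟩
  rw [← ha] at h0
  rw [← hb] at h1
  rw [← hc] at h2
  rw [← hd] at h3
  rw [← he] at h4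
  rw [← hb, ← hc, ← hd, add_comm x 1, ← he, ← ha]
  field_simp
  subst ha hb hc hd he
  ring

theorem telescope_neg_eighth {k : ℂ} (hk : Admissible k) (n : ℕ) :
    (1 / 6 + k) * (5 / 6 + k) * ramanujanTerm (-1 / 8) (k + 1) n -
        32 / 27 * (1 + k) ^ 2 * ramanujanTerm (-1 / 8) k n =
      certificate (fun k n => 48 * n ^ 2 + (48 + 128 * k) * n + (-4 + 32 * k + 80 * k ^ 2))
        (-1 / 8) k (n + 1) -
      certificate (fun k n => 48 * n ^ 2 + (48 + 128 * k) * n + (-4 + 32 * k + 80 * k ^ 2))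
        (-1 / 8) k n := by
  have h0 := hk.half_add_ne_zero
  have h1 := hk.one_add_add_ne_zero n
  have h2 := hk.one_add_two_mul_add_ne_zero n
  have h3 := hk.two_add_two_mul_add_ne_zero n
  have h4 : (1 + n : ℂ) ≠ 0 := by rw [add_comm]; exact_mod_cast n.succ_ne_zero
  rw [mul_ramanujanTerm_add_one hk, ramanujanTerm_eq_sharedFactor_mul hk, certificate,
    certificate, sharedFactor_succ hk]
  push_cast
  rw [show 1 + 2 * k + ((n : ℂ) + 1) = 2 + 2 * k + n by ring]
  generalize sharedFactor (-1 / 8) k n = s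
  generalize (n : ℂ) = x at *
  obtain ⟨a, ha⟩ : ∃ a, a = 1 / 2 + k := ⟨_, rfl⟩
  obtain ⟨b, hb⟩ : ∃ b, b = 1 + k + x := ⟨_, rfl⟩
  obtain ⟨c, hc⟩ : ∃ c, c = 1 + 2 * k + x := ⟨_, rfl⟩
  obtain ⟨d, hd⟩ : ∃ d, d = 2 + 2 * k + x := ⟨_, rfl⟩
  obtain ⟨e, he⟩ : ∃ e, e = 1 + x := ⟨_, rfl⟩
  rw [← ha] at h0
  rw [← hb] at h1
  rw [← hc] at h2
  rw [← hd] at h3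
  rw [← he] at h4
  rw [← hb, ← hc, ← hd, add_comm x 1, ← he, ← ha]
  field_simp
  subst ha hb hc hd he
  ring

/-! ### Absolute convergence and the recurrence for the sums -/

theorem summable_of_succ_eq_mul {f q : ℕ → ℂ} {z : ℂ} (hz : ‖z‖ < 1)
    (hf : ∀ n, f (n + 1) = q n * f n) (hq : Tendsto q atTop (𝓝 z)) : Summable f := by
  obtain ⟨r, hr, hr1⟩ := exists_between hz
  refine summable_of_ratio_norm_eventually_le hr1 ?_
  filter_upwards [hq.norm.eventually (gt_mem_nhds hr)] with n hn
  rw [hf, norm_mul]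
  gcongr

theorem tendsto_add_natCast_div_add_natCast (a b : ℂ) :
    Tendsto (fun n : ℕ => (a + n) / (b + n)) atTop (𝓝 1) := by
  simpa using tendsto_add_mul_div_add_mul_atTop_nhds a b (1 : ℂ) one_ne_zero

theorem summable_pow_mul_sharedFactor {z k : ℂ} (hk : Admissible k) (hz : ‖z‖ < 1) (j : ℕ) :
    Summable fun n : ℕ => (n : ℂ) ^ j * sharedFactor z k n := by
  -- The weight (1+n)^j never vanishes, unlike n^j at n = 0, so the ratio recursion holds from the
  -- start.
  have key : Summable fun n : ℕ => (1 + n : ℂ) ^ j * sharedFactor z k n := by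
    refine summable_of_succ_eq_mul (q := fun n : ℕ => ((2 + n : ℂ) / (1 + n)) ^ j *
      (z * ((-1 / 2 - k + n) / (1 + k + n) * ((1 / 2 + k + n) / (1 + 2 * k + n)) *
        ((1 / 2 + 3 * k + n) / (1 + n))))) hz (fun n => ?_) ?_
    · have h : (1 + n : ℂ) ≠ 0 := by rw [add_comm]; exact_mod_cast n.succ_ne_zero
      rw [sharedFactor_succ hk, div_pow]
      push_cast
      rw [show (1 + ((n : ℂ) + 1)) = 2 + n by ring, div_mul_div_comm, div_mul_div_comm]
      generalize z * _ = x
      field_simp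
    · have := ((tendsto_add_natCast_div_add_natCast 2 1).pow j).mul
        ((((tendsto_add_natCast_div_add_natCast (-1 / 2 - k) (1 + k)).mul
          (tendsto_add_natCast_div_add_natCast (1 / 2 + k) (1 + 2 * k))).mul
          (tendsto_add_natCast_div_add_natCast (1 / 2 + 3 * k) 1)).const_mul z)
      simpa using this
  refine Summable.of_norm_bounded key.norm fun n => ?_
  rw [norm_mul, norm_mul, norm_pow, norm_pow]
  gcongr
  have h : ‖(1 + n : ℂ)‖ = 1 + n := by
    rw [← Nat.cast_one, ← Nat.cast_add, Complex.norm_natCast]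
    push_cast
    ring
  rw [h, Complex.norm_natCast]
  linarith

theorem summable_quadratic_mul_sharedFactor {z k : ℂ} (hk : Admissible k) (hz : ‖z‖ < 1)
    (a b c : ℂ) : Summable fun n : ℕ => (a * n ^ 2 + b * n + c) * sharedFactor z k n := by
  have h := (((summable_pow_mul_sharedFactor hk hz 2).mul_left a).add
    ((summable_pow_mul_sharedFactor hk hz 1).mul_left b)).add
    ((summable_pow_mul_sharedFactor hk hz 0).mul_left c)
  refine h.congr fun n => ?_
  ring

theorem summable_ramanujanTerm {z k : ℂ} (hk : Admissible k) (hz : ‖z‖ < 1) :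
    Summable (ramanujanTerm z k) := by
  refine (summable_quadratic_mul_sharedFactor hk hz (-6 / (1 / 2 + k)) (2 / (1 / 2 + k))
    ((1 / 2 + k) * (6 * k + 1) / (1 / 2 + k))).congr fun n => ?_
  rw [ramanujanTerm_eq_sharedFactor_mul hk]
  ring

theorem tendsto_certificate {z k : ℂ} (hk : Admissible k) (hz : ‖z‖ < 1) {p : ℂ → ℂ → ℂ}
    {a b c : ℂ} (hp : ∀ n, p k n = a * n ^ 2 + b * n + c) :
    Tendsto (certificate p z k) atTop (𝓝 0) := by
  have h := (((summable_quadratic_mul_sharedFactor hk hz a b c).tendsto_atTop_zero.mul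
    (tendsto_add_natCast_div_add_natCast 0 (1 + 2 * k))).const_mul
      (-(4 * (1 + k) ^ 2 / 27) / (1 / 2 + k)))
  simp only [zero_mul, mul_zero] at h
  refine h.congr fun n => ?_
  rw [certificate, hp]
  simp only [div_eq_mul_inv, mul_inv, zero_add]
  ring

theorem tsum_ramanujanTerm_add_one {z k b : ℂ} (hk : Admissible k) (hz : ‖z‖ < 1)
    {p : ℂ → ℂ → ℂ} {α β γ : ℂ} (hp : ∀ n, p k n = α * n ^ 2 + β * n + γ)
    (h : ∀ n, (1 / 6 + k) * (5 / 6 + k) * ramanujanTerm z (k + 1) n -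
      b * (1 + k) ^ 2 * ramanujanTerm z k n = certificate p z k (n + 1) - certificate p z k n) :
    (1 / 6 + k) * (5 / 6 + k) * ∑' n, ramanujanTerm z (k + 1) n =
      b * (1 + k) ^ 2 * ∑' n, ramanujanTerm z k n := by
  have h1 := ((summable_ramanujanTerm hk.add_one hz).hasSum.mul_left
    ((1 / 6 + k) * (5 / 6 + k))).sub
      ((summable_ramanujanTerm hk hz).hasSum.mul_left (b * (1 + k) ^ 2))
  have h2 := h1.tendsto_sum_nat
  simp only [h, Finset.sum_range_sub] at h2
  have h3 := (tendsto_certificate hk hz hp).sub_const (certificate p z k 0)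
  have h4 := tendsto_nhds_unique h2 h3
  -- The certificate carries a factor n, so the boundary term at n = 0 vanishes.
  simp only [certificate, Nat.cast_zero, zero_mul, zero_div, mul_zero, sub_zero] at h4
  exact sub_eq_zero.mp h4

theorem norm_quarter_lt_one : ‖(1 / 4 : ℂ)‖ < 1 := by norm_num

theorem norm_neg_eighth_lt_one : ‖(-1 / 8 : ℂ)‖ < 1 := by norm_num

theorem tsum_recurrence_quarter {k : ℂ} (hk : Admissible k) :
    (1 / 6 + k) * (5 / 6 + k) * ∑' n, ramanujanTerm (1 / 4) (k + 1) n =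
      ((16 / 27 : ℝ) : ℂ) * (1 + k) ^ 2 * ∑' n, ramanujanTerm (1 / 4) k n := by
  push_cast
  exact tsum_ramanujanTerm_add_one hk norm_quarter_lt_one (fun _ => rfl) (telescope_quarter hk)

theorem tsum_recurrence_neg_eighth {k : ℂ} (hk : Admissible k) :
    (1 / 6 + k) * (5 / 6 + k) * ∑' n, ramanujanTerm (-1 / 8) (k + 1) n =
      ((32 / 27 : ℝ) : ℂ) * (1 + k) ^ 2 * ∑' n, ramanujanTerm (-1 / 8) k n := by
  push_cast
  exact tsum_ramanujanTerm_add_one hk norm_neg_eighth_lt_one (fun _ => rfl)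
    (telescope_neg_eighth hk)

/-! ### Growth and holomorphy of the sums on the right half-plane -/

theorem Complex.norm_le_norm_of_im_eq {a b : ℂ} (him : a.im = b.im) (h0 : 0 ≤ a.re)
    (hre : a.re ≤ b.re) : ‖a‖ ≤ ‖b‖ := by
  rw [Complex.norm_def, Complex.norm_def, Complex.normSq_apply, Complex.normSq_apply, him]
  have := h0.trans hre
  gcongr

theorem norm_risingNat_le {x : ℂ} {m : ℕ} (hx : ‖x‖ ≤ m + 1) (n : ℕ) :
    ‖risingNat x n‖ ≤ (m + 1).ascFactorial n := by
  induction n with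
  | zero => simp [risingNat_zero]
  | succ n ih =>
    rw [risingNat_succ, norm_mul, Nat.ascFactorial_succ, mul_comm]
    push_cast
    gcongr
    calc ‖x + n‖ ≤ ‖x‖ + ‖(n : ℂ)‖ := norm_add_le _ _
      _ ≤ m + 1 + n := by rw [Complex.norm_natCast]; gcongr

theorem norm_risingNat_le_pow_mul {x y : ℂ} {c : ℝ} (hc : 0 ≤ c)
    (h : ∀ n : ℕ, ‖x + n‖ ≤ c * ‖y + n‖) (n : ℕ) : ‖risingNat x n‖ ≤ c ^ n * ‖risingNat y n‖ := by
  induction n with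
  | zero => simp [risingNat_zero]
  | succ n ih =>
    rw [risingNat_succ, risingNat_succ, norm_mul, norm_mul, pow_succ, mul_mul_mul_comm]
    exact mul_le_mul ih (h n) (norm_nonneg _) (by positivity)

/-- Factor by factor, (1/2+k)_n and (1/2+3k)_n are controlled by (1+k)_n and (3/2)^n (1+2k)_n, while
(1/2-k)_n against n! gives a binomial coefficient. The geometric ratio is 1/4 · 3/2 = 3/8. -/
theorem norm_ramanujanTerm_le {z k : ℂ} (hz : ‖z‖ ≤ 1 / 4) (hk : 0 < k.re) {m : ℕ}
    (hm : ‖k‖ ≤ m) (n : ℕ) :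
    ‖ramanujanTerm z k n‖ ≤
      6 * (m + 1) * ((n + (m + 1)).choose (m + 1) * (3 / 8 : ℝ) ^ n) := by
  have ha := Admissible.of_re_pos hk
  have hA : ‖risingNat (1 / 2 - k) n‖ ≤ (m + 1).ascFactorial n := norm_risingNat_le (by
    calc ‖1 / 2 - k‖ ≤ ‖(1 / 2 : ℂ)‖ + ‖k‖ := norm_sub_le _ _
      _ ≤ m + 1 := by norm_num; linarith) n
  have hB : ‖risingNat (1 / 2 + k) n‖ ≤ 1 ^ n * ‖risingNat (1 + k) n‖ :=
    norm_risingNat_le_pow_mul zero_le_one (fun n => by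
      rw [one_mul]
      have hn : (0 : ℝ) ≤ n := n.cast_nonneg
      apply Complex.norm_le_norm_of_im_eq <;> simp <;> first | positivity | norm_num) n
  have hC : ‖risingNat (1 / 2 + 3 * k) n‖ ≤ (3 / 2) ^ n * ‖risingNat (1 + 2 * k) n‖ :=
    norm_risingNat_le_pow_mul (by norm_num) (fun n => by
      have hn : (0 : ℝ) ≤ n := n.cast_nonneg
      -- The scale 3/2 makes both imaginary parts 3 Im k, leaving only real parts to compare.
      have h : (3 / 2 : ℝ) * ‖1 + 2 * k + n‖ = ‖((3 / 2 : ℝ) : ℂ) * (1 + 2 * k + n)‖ := by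
        rw [norm_mul, Complex.norm_real]; norm_num
      rw [h]
      apply Complex.norm_le_norm_of_im_eq
      · simp; ring
      · simp; positivity
      · simp; linarith) n
  have hD : 0 < ‖risingNat (1 + k) n‖ := norm_pos_iff.mpr (risingNat_ne_zero ha.one_add_add_ne_zero n)
  have hE : 0 < ‖risingNat (1 + 2 * k) n‖ :=
    norm_pos_iff.mpr (risingNat_ne_zero ha.one_add_two_mul_add_ne_zero n)
  have hF : ‖risingNat 1 n‖ = n.factorial := by
    rw [risingNat, ascPochhammer_eval_one, Complex.norm_natCast]
  have hF0 : (0 : ℝ) < n.factorial := by exact_mod_cast n.factorial_pos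
  have hL : ‖(6 * n + 6 * k + 1 : ℂ)‖ ≤ 6 * (n + m + 1) := by
    calc ‖(6 * n + 6 * k + 1 : ℂ)‖ ≤ ‖(6 * n : ℂ)‖ + ‖6 * k‖ + ‖(1 : ℂ)‖ := norm_add₃_le
      _ ≤ 6 * (n + m + 1) := by
        rw [norm_mul, norm_mul, Complex.norm_natCast, norm_one, Complex.norm_ofNat]
        linarith
  have hch : ((m + 1).ascFactorial n : ℝ) / n.factorial * (n + m + 1) =
      (m + 1) * (n + (m + 1)).choose (m + 1) := by
    rw [Nat.ascFactorial_eq_factorial_mul_choose, Nat.cast_mul, mul_div_cancel_left₀ _ hF0.ne',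
      ← Nat.choose_symm_add]
    have := Nat.add_one_mul_choose_eq (m + n) m
    have h2 : ((m + n + 1 : ℕ) : ℝ) * ((m + n).choose m : ℕ) =
      ((m + n + 1).choose (m + 1) : ℕ) * ((m + 1 : ℕ) : ℝ) := by exact_mod_cast this
    rw [show n + (m + 1) = m + n + 1 by ring]
    push_cast at h2
    linear_combination h2
  rw [ramanujanTerm, norm_mul, norm_mul, norm_pow, norm_div, norm_mul, norm_mul, norm_mul,
    norm_mul, hF]
  calc ‖z‖ ^ n * (‖risingNat (1 / 2 - k) n‖ * ‖risingNat (1 / 2 + k) n‖ *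
        ‖risingNat (1 / 2 + 3 * k) n‖ /
        (‖risingNat (1 + k) n‖ * ‖risingNat (1 + 2 * k) n‖ * n.factorial)) *
        ‖(6 * n + 6 * k + 1 : ℂ)‖
      ≤ (1 / 4) ^ n * ((m + 1).ascFactorial n * (1 ^ n * ‖risingNat (1 + k) n‖) *
        ((3 / 2) ^ n * ‖risingNat (1 + 2 * k) n‖) /
        (‖risingNat (1 + k) n‖ * ‖risingNat (1 + 2 * k) n‖ * n.factorial)) *
        (6 * (n + m + 1)) := by gcongr
    _ = 6 * ((1 / 4) ^ n * (3 / 2) ^ n) *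
        (((m + 1).ascFactorial n : ℝ) / n.factorial * (n + m + 1)) := by
      generalize ‖risingNat (1 + 2 * k) n‖ = E at *
      rw [one_pow]
      field_simp
    _ = _ := by
      rw [hch, ← mul_pow]
      norm_num
      ring

theorem summable_choose_bound (m : ℕ) : Summable fun n : ℕ =>
    6 * (m + 1 : ℝ) * ((n + (m + 1)).choose (m + 1) * (3 / 8 : ℝ) ^ n) :=
  (summable_choose_mul_geometric_of_norm_lt_one (m + 1)
    (r := (3 / 8 : ℝ)) (by norm_num)).mul_left _

/-- The negative binomial series sums the majorant, with 1/(1 - 3/8) = 8/5. -/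
theorem norm_tsum_ramanujanTerm_le {z k : ℂ} (hz : ‖z‖ ≤ 1 / 4) (hk : 0 < k.re) {m : ℕ}
    (hm : ‖k‖ ≤ m) : ‖∑' n, ramanujanTerm z k n‖ ≤ 6 * (m + 1) * (8 / 5) ^ (m + 2) := by
  refine (tsum_of_norm_bounded (summable_choose_bound m).hasSum
    (norm_ramanujanTerm_le hz hk hm)).trans_eq ?_
  rw [tsum_mul_left, tsum_choose_mul_geometric_of_norm_lt_one (m + 1) (by norm_num)]
  rw [one_div, ← inv_pow]
  norm_num

theorem differentiable_risingNat (n : ℕ) : Differentiable ℂ fun x => risingNat x n :=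
  (ascPochhammer ℂ n).differentiable

theorem differentiableOn_tsum_ramanujanTerm {z : ℂ} (hz : ‖z‖ ≤ 1 / 4) :
    DifferentiableOn ℂ (fun k => ∑' n, ramanujanTerm z k n) {k | 0 < k.re} := by
  intro k hk
  obtain ⟨m, hm⟩ := exists_nat_gt ‖k‖
  -- The majorant is uniform only for bounded k, so holomorphy is proved on bounded pieces.
  have ho : IsOpen {k : ℂ | 0 < k.re ∧ ‖k‖ < m} :=
    (isOpen_lt continuous_const Complex.continuous_re).inter
      (isOpen_lt continuous_norm continuous_const)
  refine DifferentiableAt.differentiableWithinAt ?_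
  refine DifferentiableOn.differentiableAt (s := {k : ℂ | 0 < k.re ∧ ‖k‖ < m}) ?_
    (ho.mem_nhds ⟨hk, hm⟩)
  refine Complex.differentiableOn_tsum_of_summable_norm (summable_choose_bound m) (fun n => ?_) ho
    fun n w hw => norm_ramanujanTerm_le hz hw.1 hw.2.le n
  intro w hw
  have ha := Admissible.of_re_pos hw.1
  have hd := differentiable_risingNat n
  refine DifferentiableAt.differentiableWithinAt ?_
  simp only [ramanujanTerm]
  refine ((DifferentiableAt.div ?_ ?_ ?_).const_mul _).mul (by fun_prop)
  · exact ((hd.comp (by fun_prop : Differentiable ℂ fun k : ℂ => 1 / 2 - k)).mul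
      (hd.comp (by fun_prop : Differentiable ℂ fun k : ℂ => 1 / 2 + k))).mul
      (hd.comp (by fun_prop : Differentiable ℂ fun k : ℂ => 1 / 2 + 3 * k)) w
  · exact ((hd.comp (by fun_prop : Differentiable ℂ fun k : ℂ => 1 + k)).mul
      (hd.comp (by fun_prop : Differentiable ℂ fun k : ℂ => 1 + 2 * k))).mul_const _ w
  · exact mul_ne_zero (mul_ne_zero (risingNat_ne_zero ha.one_add_add_ne_zero n)
      (risingNat_ne_zero ha.one_add_two_mul_add_ne_zero n)) (risingNat_one_ne_zero n)

theorem tsum_ramanujanTerm_half (z : ℂ) : ∑' n, ramanujanTerm z (1 / 2) n = 4 := by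
  rw [tsum_eq_single 0]
  · simp [ramanujanTerm, risingNat_zero]; norm_num
  · intro n hn
    have : risingNat (1 / 2 - 1 / 2) n = 0 := by
      rw [sub_self, risingNat, ascPochhammer_ne_zero_eval_zero ℂ hn]
    rw [ramanujanTerm, this]; simp

/-! ### Periodic functions of small exponential type -/

theorem Real.exp_abs_log_div_two_of_one_le {r : ℝ} (hr : 1 ≤ r) :
    Real.exp (|Real.log r| / 2) = √r := by
  rw [abs_of_nonneg (Real.log_nonneg hr), Real.exp_half, Real.exp_log (by linarith)]

theorem Real.mul_exp_abs_log_div_two_of_le_one {r : ℝ} (hr0 : 0 < r) (hr : r ≤ 1) :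
    r * Real.exp (|Real.log r| / 2) = √r := by
  rw [abs_of_nonpos (Real.log_nonpos hr0.le hr), neg_div, Real.exp_neg, Real.exp_half,
    Real.exp_log hr0, ← div_eq_mul_inv, Real.div_sqrt]

/-- An entire function growing at most like the square root is constant. -/
theorem deriv_eq_zero_of_norm_le_sqrt {g : ℂ → ℂ} (hg : Differentiable ℂ g) {C : ℝ}
    (hC : 0 ≤ C) (hb : ∀ q, 1 ≤ ‖q‖ → ‖g q‖ ≤ C * √‖q‖) (c : ℂ) : deriv g c = 0 := by
  -- Cauchy's estimate on the circle of radius R about c, where 1 ≤ ‖w‖ ≤ 2R.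
  have key : ∀ R : ℝ, 1 + ‖c‖ ≤ R → ‖deriv g c‖ ≤ C * √2 * (√R)⁻¹ := by
    intro R hR
    have hR0 : 0 < R := by linarith [norm_nonneg c]
    have h := Complex.norm_deriv_le_of_forall_mem_sphere_norm_le (f := g) (c := c) hR0
      (C := C * √(2 * R)) hg.diffContOnCl (fun w hw => by
        rw [mem_sphere_iff_norm] at hw
        have h1 : ‖w‖ ≤ ‖w - c‖ + ‖c‖ := by simpa using norm_add_le (w - c) c
        have h2 : ‖w - c‖ ≤ ‖w‖ + ‖c‖ := norm_sub_le w c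
        refine (hb w (by linarith)).trans ?_
        gcongr
        linarith [norm_nonneg c])
    refine h.trans_eq ?_
    rw [Real.sqrt_mul zero_le_two, mul_div_assoc, mul_div_assoc, Real.sqrt_div_self', one_div,
      mul_assoc]
  have ht : Tendsto (fun R : ℝ => C * √2 * (√R)⁻¹) atTop (𝓝 0) := by
    simpa using (tendsto_inv_atTop_zero.comp Real.tendsto_sqrt_atTop).const_mul (C * √2)
  have := ge_of_tendsto ht (eventually_atTop.mpr ⟨_, key⟩)
  exact norm_le_zero_iff.mp this

open Function.Periodic in
/-- An entire function of period `1` and exponential type at most `π` in the imaginary direction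
is constant. -/
theorem Function.Periodic.eq_of_norm_le_exp {F : ℂ → ℂ} (hF : Differentiable ℂ F)
    (hper : Function.Periodic F 1) {C : ℝ} (hb : ∀ k, ‖F k‖ ≤ C * Real.exp (Real.pi * |k.im|))
    (k w : ℂ) : F k = F w := by
  have hC : 0 ≤ C := by
    have := (norm_nonneg _).trans (hb 0)
    simpa using this
  have hper' : Function.Periodic F ((1 : ℝ) : ℂ) := by simpa using hper
  -- F viewed as a function of q = exp(2πik); exp(π|Im k|) becomes exp(|log ‖q‖|/2).
  set g := cuspFunction 1 F with hgdef
  have hgb : ∀ q, q ≠ 0 → ‖g q‖ ≤ C * Real.exp (|Real.log ‖q‖| / 2) := by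
    intro q hq
    rw [hgdef, cuspFunction_eq_of_nonzero _ _ hq]
    refine (hb _).trans_eq ?_
    rw [im_invQParam, abs_mul, abs_div, abs_neg, abs_one, abs_of_pos Real.two_pi_pos]
    congr 2
    field_simp
  have hgd : ∀ q, q ≠ 0 → DifferentiableAt ℂ g q := by
    intro q hq
    rw [← qParam_right_inv one_ne_zero hq]
    exact differentiableAt_cuspFunction one_ne_zero hper' (hF _)
  -- Growth ‖q‖^(-1/2) is o(1/‖q‖), so the singularity at 0 is removable.
  have hgo : (fun q => g q - g 0) =o[𝓝[≠] (0 : ℂ)] fun q => (q - 0)⁻¹ := by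
    have hs : Tendsto (fun q : ℂ => C * √‖q‖ + ‖q‖ * ‖g 0‖) (𝓝[≠] 0) (𝓝 0) := by
      have : Continuous fun q : ℂ => C * √‖q‖ + ‖q‖ * ‖g 0‖ := by fun_prop
      have := (this.tendsto 0).mono_left (nhdsWithin_le_nhds (s := {0}ᶜ))
      simpa using this
    rw [Asymptotics.isLittleO_iff_tendsto' (by
      filter_upwards [self_mem_nhdsWithin] with q hq h
      simp at h
      exact absurd h hq)]
    refine squeeze_zero_norm' ?_ hs
    have h1 : ∀ᶠ q : ℂ in 𝓝[≠] 0, ‖q‖ < 1 := by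
      refine nhdsWithin_le_nhds ?_
      exact (isOpen_lt continuous_norm continuous_const).mem_nhds (by simp)
    filter_upwards [h1, self_mem_nhdsWithin] with q hq1 hq0
    have hq : 0 < ‖q‖ := norm_pos_iff.mpr hq0
    rw [sub_zero, div_inv_eq_mul, norm_mul, mul_comm,
      ← Real.mul_exp_abs_log_div_two_of_le_one hq hq1.le]
    calc ‖q‖ * ‖g q - g 0‖ ≤ ‖q‖ * (‖g q‖ + ‖g 0‖) := by gcongr; exact norm_sub_le _ _
      _ ≤ ‖q‖ * (C * Real.exp (|Real.log ‖q‖| / 2) + ‖g 0‖) := by gcongr; exact hgb q hq0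
      _ = _ := by ring
  have hdiff : Differentiable ℂ g := by
    have h := Complex.differentiableOn_update_limUnder_of_isLittleO (s := Set.univ) univ_mem
      (fun q hq => (hgd q (by simpa using hq)).differentiableWithinAt) hgo
    rw [hgdef, ← cuspFunction_zero_eq_limUnder_nhds_ne, Function.update_eq_self] at h
    exact differentiableOn_univ.mp h
  have hconst := is_const_of_deriv_eq_zero hdiff
    (deriv_eq_zero_of_norm_le_sqrt hdiff hC fun q hq => by
      rw [← Real.exp_abs_log_div_two_of_one_le hq]
      exact hgb q (norm_pos_iff.mp (by linarith)))
  rw [← eq_cuspFunction one_ne_zero hper' k, ← eq_cuspFunction one_ne_zero hper' w]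
  exact hconst _ _

/-- A function holomorphic on the right half-plane, of period `1` and exponential type at most `π`
in the imaginary direction, is constant. -/
theorem eq_of_periodic_of_norm_le_exp {f : ℂ → ℂ} (hd : DifferentiableOn ℂ f {k | 0 < k.re})
    (hper : ∀ k, 0 < k.re → f (k + 1) = f k) {C : ℝ}
    (hb : ∀ k, 0 < k.re → k.re ≤ 1 → ‖f k‖ ≤ C * Real.exp (Real.pi * |k.im|))
    {k w : ℂ} (hk : 0 < k.re) (hw : 0 < w.re) : f k = f w := by
  have hnat : ∀ (n : ℕ) (k : ℂ), 0 < k.re → f (k + n) = f k := by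
    intro n
    induction n with
    | zero => simp
    | succ n ih =>
      intro k hk
      rw [Nat.cast_succ, ← add_assoc, hper _ (by simp; positivity), ih k hk]
  have htwo : ∀ (n m : ℕ) (k : ℂ), 0 < k.re + n → 0 < k.re + m → f (k + n) = f (k + m) := by
    intro n m k hn hm
    rw [← hnat m (k + n) (by simpa using hn), ← hnat n (k + m) (by simpa using hm), add_right_comm]
  have hceil : ∀ k : ℂ, 0 < k.re + ((⌈|k.re|⌉₊ + 1 : ℕ) : ℝ) := by
    intro k
    have h1 := Nat.le_ceil |k.re|
    have h2 := neg_abs_le k.re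
    push_cast
    linarith
  -- Periodicity extends f to the whole plane: translate far enough right, with +1 for strict
  -- positivity.
  set F : ℂ → ℂ := fun k => f (k + (⌈|k.re|⌉₊ + 1 : ℕ)) with hFdef
  have hFf : ∀ (n : ℕ) (k : ℂ), 0 < k.re + n → F k = f (k + n) := fun n k hn =>
    htwo _ _ _ (hceil k) hn
  have hFf0 : ∀ k : ℂ, 0 < k.re → F k = f k := fun k hk => by
    simpa using hFf 0 k (by simpa using hk)
  have hFper : Function.Periodic F 1 := by
    intro k
    have h := hceil (k + 1)
    rw [hFf _ (k + 1) h, hFf ((⌈|(k + 1).re|⌉₊ + 1) + 1) k (by simp at h ⊢; linarith)]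
    push_cast
    ring_nf
  have hFd : Differentiable ℂ F := by
    intro k
    set n := ⌈|k.re|⌉₊ + 1
    have ho : IsOpen {k : ℂ | 0 < k.re + n} :=
      isOpen_lt continuous_const (Complex.continuous_re.add continuous_const)
    have hn : k ∈ {k : ℂ | 0 < k.re + n} := hceil k
    have hopen : IsOpen {k : ℂ | 0 < k.re} := isOpen_lt continuous_const Complex.continuous_re
    have h1 : DifferentiableAt ℂ (fun k : ℂ => f (k + n)) k :=
      DifferentiableAt.comp k (hd.differentiableAt (hopen.mem_nhds (by simpa using hn)))
        (differentiableAt_id.add_const _)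
    refine h1.congr_of_eventuallyEq ?_
    filter_upwards [ho.mem_nhds hn] with w hw using hFf n w hw
  have hFb : ∀ k, ‖F k‖ ≤ C * Real.exp (Real.pi * |k.im|) := by
    intro k
    -- This translation brings the real part into (0, 1], where the bound on f is assumed.
    have h := hFper.int_mul (1 - ⌈k.re⌉) k
    rw [← h, mul_one]
    have h1 := Int.le_ceil k.re
    have h2 := Int.ceil_lt_add_one k.re
    have h3 : 0 < (k + ((1 - ⌈k.re⌉ : ℤ) : ℂ)).re := by simp; linarith
    rw [hFf0 _ h3]
    refine (hb _ h3 (by simp; linarith)).trans_eq ?_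
    simp
  rw [← hFf0 k hk, ← hFf0 w hw]
  exact Function.Periodic.eq_of_norm_le_exp hFd hFper hFb k w

/-! ### Bounds and recurrences for the Gamma factors -/

theorem norm_betaIntegral_le {u v : ℂ} {r s : ℝ} (hr : 0 < r) (hs : 0 < s) (hu : r ≤ u.re)
    (hv : s ≤ v.re) : ‖Complex.betaIntegral u v‖ ≤
      ∫ x : ℝ in 0..1, ‖(x : ℂ) ^ ((r : ℂ) - 1) * (1 - (x : ℂ)) ^ ((s : ℂ) - 1)‖ := by
  refine intervalIntegral.norm_integral_le_of_norm_le zero_le_one ?_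
    (Complex.betaIntegral_convergent (by simpa using hr) (by simpa using hs)).norm
  have h1 : ∀ᵐ x : ℝ, x ≠ 1 := by simp [MeasureTheory.ae_iff]
  filter_upwards [h1] with x hx1 hx
  have hx0 : 0 < x := hx.1
  have hx' : 0 < 1 - x := sub_pos.mpr (lt_of_le_of_ne hx.2 hx1)
  have e : (1 - (x : ℂ)) = ((1 - x : ℝ) : ℂ) := by push_cast; rfl
  rw [e, norm_mul, norm_mul, Complex.norm_cpow_eq_rpow_re_of_pos hx0,
    Complex.norm_cpow_eq_rpow_re_of_pos hx0, Complex.norm_cpow_eq_rpow_re_of_pos hx',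
    Complex.norm_cpow_eq_rpow_re_of_pos hx']
  gcongr ?_ * ?_
  · exact Real.rpow_le_rpow_of_exponent_ge hx0 hx.2 (by simpa using hu)
  · exact Real.rpow_le_rpow_of_exponent_ge hx' (by linarith) (by simpa using hv)

/-- `Γ(a + k) / Γ(1 + k)` is bounded on the right half-plane for `0 < a < 1`. -/
theorem exists_norm_Gamma_div_Gamma_le {a : ℝ} (ha0 : 0 < a) (ha1 : a < 1) :
    ∃ M : ℝ, ∀ k : ℂ, 0 < k.re → ‖Complex.Gamma (a + k) / Complex.Gamma (1 + k)‖ ≤ M := by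
  have hb : 0 < 1 - a := sub_pos.mpr ha1
  refine ⟨(∫ x : ℝ in 0..1, ‖(x : ℂ) ^ ((a : ℂ) - 1) * (1 - (x : ℂ)) ^ (((1 - a : ℝ) : ℂ) - 1)‖) /
    ‖Complex.Gamma ((1 - a : ℝ) : ℂ)‖, fun k hk => ?_⟩
  have h1 : 0 < (a + k : ℂ).re := by simp; positivity
  have h2 := Complex.Gamma_mul_Gamma_eq_betaIntegral h1
    (t := ((1 - a : ℝ) : ℂ)) (by simpa using ha1)
  have h3 : (a + k : ℂ) + ((1 - a : ℝ) : ℂ) = 1 + k := by push_cast; ring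
  have h4 : Complex.Gamma (1 + k) ≠ 0 := Complex.Gamma_ne_zero_of_re_pos (by simp; positivity)
  have h5 : Complex.Gamma ((1 - a : ℝ) : ℂ) ≠ 0 :=
    Complex.Gamma_ne_zero_of_re_pos (by simpa using ha1)
  rw [h3] at h2
  -- As a Beta integral the quotient is bounded uniformly, because |x^(a+k-1)| ≤ x^(a-1) on (0, 1].
  have h6 : Complex.Gamma (a + k) / Complex.Gamma (1 + k) =
      Complex.betaIntegral (a + k) ((1 - a : ℝ) : ℂ) / Complex.Gamma ((1 - a : ℝ) : ℂ) := by
    rw [div_eq_div_iff h4 h5, h2, mul_comm]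
  rw [h6, norm_div]
  gcongr
  exact norm_betaIntegral_le ha0 hb (by simpa using hk.le) (by simp)

/-- The reciprocal of the Gamma quotient on the right-hand side, up to a constant factor. -/
noncomputable def gammaWeight (b : ℝ) (k : ℂ) : ℂ :=
  (b : ℂ) ^ (-k) * (Complex.Gamma ((1 / 6 : ℝ) + k) / Complex.Gamma (1 + k)) *
    (Complex.Gamma ((5 / 6 : ℝ) + k) / Complex.Gamma (1 + k))

theorem gammaWeight_add_one {b : ℝ} (hb : 0 < b) {k : ℂ} (hk : 0 < k.re) :
    b * (1 + k) ^ 2 * gammaWeight b (k + 1) = (1 / 6 + k) * (5 / 6 + k) * gammaWeight b k := by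
  have hb0 : (b : ℂ) ≠ 0 := by exact_mod_cast hb.ne'
  have ne : ∀ a : ℝ, 0 < a → (a : ℂ) + k ≠ 0 := fun a ha h => by
    have := congrArg Complex.re h
    simp at this
    linarith
  have h1 := Complex.Gamma_add_one _ (ne (1 / 6) (by norm_num))
  have h2 := Complex.Gamma_add_one _ (ne (5 / 6) (by norm_num))
  have ne1 : 1 + k ≠ 0 := by simpa using ne 1 one_pos
  have h3 := Complex.Gamma_add_one _ ne1
  have h4 : Complex.Gamma (1 + k) ≠ 0 := Complex.Gamma_ne_zero_of_re_pos (by simp; positivity)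
  have h5 : (b : ℂ) ^ (-(k + 1)) = (b : ℂ) ^ (-k) / b := by
    rw [neg_add, ← sub_eq_add_neg, Complex.cpow_sub _ _ hb0, Complex.cpow_one]
  rw [gammaWeight, gammaWeight, ← add_assoc, ← add_assoc, ← add_assoc, h1, h2, h3, h5]
  push_cast
  field_simp

theorem differentiableOn_gammaWeight {b : ℝ} (hb : 0 < b) :
    DifferentiableOn ℂ (gammaWeight b) {k | 0 < k.re} := by
  have hb0 : (b : ℂ) ≠ 0 := by exact_mod_cast hb.ne'
  intro k hk
  have hk' : 0 < k.re := hk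
  have hG : ∀ a : ℝ, 0 < a → DifferentiableAt ℂ (fun k : ℂ => Complex.Gamma (a + k)) k := by
    intro a ha
    refine DifferentiableAt.comp k (Complex.differentiableAt_Gamma _ fun m h => ?_)
      (differentiableAt_id.const_add _)
    have := congrArg Complex.re h
    simp at this
    have : (0 : ℝ) ≤ m := m.cast_nonneg
    linarith
  have hG1 : DifferentiableAt ℂ (fun k : ℂ => Complex.Gamma (1 + k)) k := by
    simpa using hG 1 one_pos
  have h4 : Complex.Gamma (1 + k) ≠ 0 := Complex.Gamma_ne_zero_of_re_pos (by simp; positivity)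
  refine DifferentiableAt.differentiableWithinAt ?_
  exact ((differentiableAt_id.neg.const_cpow (Or.inl hb0)).mul
    ((hG _ (by norm_num)).div hG1 h4)).mul ((hG _ (by norm_num)).div hG1 h4)

theorem exists_norm_gammaWeight_le {b : ℝ} (hb : 0 < b) :
    ∃ M : ℝ, ∀ k : ℂ, 0 < k.re → k.re ≤ 1 → ‖gammaWeight b k‖ ≤ M := by
  obtain ⟨M₁, h1⟩ := exists_norm_Gamma_div_Gamma_le (a := 1 / 6) (by norm_num) (by norm_num)
  obtain ⟨M₂, h2⟩ := exists_norm_Gamma_div_Gamma_le (a := 5 / 6) (by norm_num) (by norm_num)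
  refine ⟨(1 + b⁻¹) * M₁ * M₂, fun k hk hk1 => ?_⟩
  -- On the strip this norm is b⁻¹ to a power in (0, 1], hence at most max(1, b⁻¹).
  have h3 : ‖(b : ℂ) ^ (-k)‖ ≤ 1 + b⁻¹ := by
    rw [Complex.norm_cpow_eq_rpow_re_of_pos hb, Complex.neg_re, Real.rpow_neg hb.le,
      ← Real.inv_rpow hb.le]
    rcases le_total b⁻¹ 1 with h | h
    · have := Real.rpow_le_one (by positivity) h hk.le
      have : 0 < b⁻¹ := by positivity
      linarith
    · have := Real.rpow_le_rpow_of_exponent_le h hk1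
      rw [Real.rpow_one] at this
      linarith
  rw [gammaWeight, norm_mul, norm_mul]
  have h4 := h1 k hk
  have h5 := h2 k hk
  have := (norm_nonneg _).trans h4
  gcongr

/-! ### Determining the sums -/

/-- The linear and the exponential factor are each O(exp t), and 2 < π. -/
theorem exists_polynomial_mul_pow_le_exp :
    ∃ C : ℝ, ∀ t : ℝ, 0 ≤ t → ∀ m : ℕ, (m : ℝ) ≤ t + 2 →
      6 * (m + 1 : ℝ) * (8 / 5) ^ (m + 2) ≤ C * Real.exp (Real.pi * t) := by
  refine ⟨6 * (8 / 5) ^ 2 * Real.exp 2 * Real.exp 2 * Real.exp 1, fun t ht m hm => ?_⟩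
  have h1 : (8 / 5 : ℝ) ≤ Real.exp 1 := by linarith [Real.add_one_le_exp (1 : ℝ)]
  have h2 : (8 / 5 : ℝ) ^ m ≤ Real.exp (t + 2) := by
    calc (8 / 5 : ℝ) ^ m ≤ Real.exp 1 ^ m := by gcongr
      _ = Real.exp m := by rw [← Real.exp_nat_mul, mul_one]
      _ ≤ _ := Real.exp_le_exp.mpr hm
  have h3 : (m + 1 : ℝ) ≤ Real.exp (t + 2) := by
    linarith [Real.add_one_le_exp (t + 2)]
  have h4 : Real.exp (t + t) ≤ Real.exp (Real.pi * t) :=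
    Real.exp_le_exp.mpr (by nlinarith [Real.pi_gt_three])
  have h5 : (1 : ℝ) ≤ Real.exp 1 := by linarith
  rw [pow_add]
  calc 6 * (m + 1 : ℝ) * ((8 / 5) ^ m * (8 / 5) ^ 2)
      ≤ 6 * Real.exp (t + 2) * (Real.exp (t + 2) * (8 / 5) ^ 2) := by gcongr
    _ = 6 * (8 / 5) ^ 2 * Real.exp 2 * Real.exp 2 * 1 * Real.exp (t + t) := by
      rw [Real.exp_add, Real.exp_add]; ring
    _ ≤ _ := by gcongr

theorem tsum_mul_gammaWeight_eq {z : ℂ} {b : ℝ} (hz : ‖z‖ ≤ 1 / 4) (hb : 0 < b)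
    (hrec : ∀ k, Admissible k → (1 / 6 + k) * (5 / 6 + k) * ∑' n, ramanujanTerm z (k + 1) n =
      b * (1 + k) ^ 2 * ∑' n, ramanujanTerm z k n) {k : ℂ} (hk : 0 < k.re) :
    (∑' n, ramanujanTerm z k n) * gammaWeight b k = 4 * gammaWeight b (1 / 2) := by
  obtain ⟨M, hM⟩ := exists_norm_gammaWeight_le hb
  obtain ⟨C, hC⟩ := exists_polynomial_mul_pow_le_exp
  rw [← tsum_ramanujanTerm_half z]
  refine eq_of_periodic_of_norm_le_exp
    (f := fun k => (∑' n, ramanujanTerm z k n) * gammaWeight b k) (C := C * M)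
    ((differentiableOn_tsum_ramanujanTerm hz).mul (differentiableOn_gammaWeight hb))
    (fun k hk => ?_) (fun k hk hk1 => ?_) hk (by norm_num)
  · have ha := Admissible.of_re_pos hk
    have h1 := hrec k ha
    have h2 := gammaWeight_add_one hb hk
    have hne : (b : ℂ) * (1 + k) ^ 2 ≠ 0 :=
      mul_ne_zero (by exact_mod_cast hb.ne') (pow_ne_zero 2 ha.one_add_ne_zero)
    refine mul_left_cancel₀ hne ?_
    linear_combination (∑' n, ramanujanTerm z (k + 1) n) * h2 + gammaWeight b k * h1
  · have h1 : ‖k‖ ≤ ⌈‖k‖⌉₊ := Nat.le_ceil _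
    have h2 : (⌈‖k‖⌉₊ : ℝ) ≤ |k.im| + 2 := by
      have h3 := (Nat.ceil_lt_add_one (norm_nonneg k)).le
      have h4 := Complex.norm_le_abs_re_add_abs_im k
      rw [abs_of_pos hk] at h4
      linarith
    rw [norm_mul, mul_right_comm]
    exact mul_le_mul ((norm_tsum_ramanujanTerm_le hz hk h1).trans (hC _ (abs_nonneg _) _ h2))
      (hM k hk hk1) (norm_nonneg _) ((norm_nonneg _).trans
        ((norm_tsum_ramanujanTerm_le hz hk h1).trans (hC _ (abs_nonneg _) _ h2)))

/-- The Gamma quotient on the right-hand side, up to a constant factor. -/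
noncomputable def gammaSide (b : ℝ) (k : ℂ) : ℂ :=
  (b : ℂ) ^ k * Complex.Gamma (1 + k) ^ 2 *
    ((Complex.Gamma (1 / 6 + k))⁻¹ * (Complex.Gamma (5 / 6 + k))⁻¹)

/-- The functional equation of the entire function 1/Γ has no exceptions, so zeros of 1/Γ(1/6+k) and
1/Γ(5/6+k) need no separate case. -/
theorem gammaSide_add_one {b : ℝ} (hb : 0 < b) {k : ℂ} (hk : 1 + k ≠ 0) :
    (1 / 6 + k) * (5 / 6 + k) * gammaSide b (k + 1) = b * (1 + k) ^ 2 * gammaSide b k := by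
  have hb0 : (b : ℂ) ≠ 0 := by exact_mod_cast hb.ne'
  rw [gammaSide, gammaSide, Complex.one_div_Gamma_eq_self_mul_one_div_Gamma_add_one (1 / 6 + k),
    Complex.one_div_Gamma_eq_self_mul_one_div_Gamma_add_one (5 / 6 + k), ← add_assoc, ← add_assoc,
    ← add_assoc, Complex.Gamma_add_one _ hk, Complex.cpow_add _ _ hb0, Complex.cpow_one]
  ring

theorem gammaWeight_mul_gammaSide {b : ℝ} (hb : 0 < b) {k : ℂ} (hk : 0 < k.re) :
    gammaWeight b k * gammaSide b k = 1 := by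
  have hb0 : (b : ℂ) ≠ 0 := by exact_mod_cast hb.ne'
  have h1 : Complex.Gamma (1 + k) ≠ 0 := Complex.Gamma_ne_zero_of_re_pos (by simp; positivity)
  have h2 : Complex.Gamma (1 / 6 + k) ≠ 0 :=
    Complex.Gamma_ne_zero_of_re_pos (by simp; positivity)
  have h3 : Complex.Gamma (5 / 6 + k) ≠ 0 :=
    Complex.Gamma_ne_zero_of_re_pos (by simp; positivity)
  have h4 : (b : ℂ) ^ k ≠ 0 := by simp [Complex.cpow_eq_zero_iff, hb0]
  rw [gammaWeight, gammaSide, Complex.cpow_neg]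
  push_cast
  generalize Complex.Gamma (1 / 6 + k) = x at *
  generalize Complex.Gamma (5 / 6 + k) = y at *
  field_simp

/-- Descent by unit steps from Re k > 0: solving for S(k) divides by b(1+k)², nonzero for admissible
k. -/
theorem tsum_ramanujanTerm_eq_gammaSide {z : ℂ} {b : ℝ} (hz : ‖z‖ ≤ 1 / 4) (hb : 0 < b)
    (hrec : ∀ k, Admissible k → (1 / 6 + k) * (5 / 6 + k) * ∑' n, ramanujanTerm z (k + 1) n =
      b * (1 + k) ^ 2 * ∑' n, ramanujanTerm z k n) {k : ℂ} (hk : Admissible k) :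
    ∑' n, ramanujanTerm z k n = 4 * gammaWeight b (1 / 2) * gammaSide b k := by
  have key : ∀ (N : ℕ) (k : ℂ), Admissible k → 0 < k.re + N →
      ∑' n, ramanujanTerm z k n = 4 * gammaWeight b (1 / 2) * gammaSide b k := by
    intro N
    induction N with
    | zero =>
      intro k _ hk
      have hk : 0 < k.re := by simpa using hk
      rw [← tsum_mul_gammaWeight_eq hz hb hrec hk, mul_assoc, gammaWeight_mul_gammaSide hb hk,
        mul_one]
    | succ N ih =>
      intro k hk hN
      have h1 := ih (k + 1) hk.add_one (by push_cast at hN; simp; linarith)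
      have h2 := hrec k hk
      have h3 := gammaSide_add_one hb hk.one_add_ne_zero
      have hne : (b : ℂ) * (1 + k) ^ 2 ≠ 0 :=
        mul_ne_zero (by exact_mod_cast hb.ne') (pow_ne_zero 2 hk.one_add_ne_zero)
      refine mul_left_cancel₀ hne ?_
      rw [h1] at h2
      linear_combination -h2 + 4 * gammaWeight b (1 / 2) * h3
  obtain ⟨N, hN⟩ := exists_nat_gt (-k.re)
  exact key N k hk (by linarith)

/-! ### Gamma values and the constants -/

theorem Complex.Gamma_one_third_mul_Gamma_two_thirds :
    Complex.Gamma (1 / 3) * Complex.Gamma (2 / 3) = ((2 * Real.pi / √3 : ℝ) : ℂ) := by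
  have h := Complex.Gamma_mul_Gamma_one_sub (1 / 3)
  have h1 : Complex.sin (Real.pi * (1 / 3)) = ((√3 / 2 : ℝ) : ℂ) := by
    rw [← Real.sin_pi_div_three]
    push_cast
    ring_nf
  rw [h1, show (1 - 1 / 3 : ℂ) = 2 / 3 by norm_num] at h
  rw [h, ← Complex.ofReal_div]
  congr 1
  field_simp

theorem Complex.Gamma_one_sixth_mul_Gamma_five_sixths :
    Complex.Gamma (1 / 6) * Complex.Gamma (5 / 6) = 2 * Real.pi := by
  have h := Complex.Gamma_mul_Gamma_one_sub (1 / 6)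
  have h1 : Complex.sin (Real.pi * (1 / 6)) = ((1 / 2 : ℝ) : ℂ) := by
    rw [← Real.sin_pi_div_six]
    push_cast
    ring_nf
  rw [h1, show (1 - 1 / 6 : ℂ) = 5 / 6 by norm_num] at h
  rw [h]
  push_cast
  ring

theorem gammaWeight_half {b : ℝ} (hb : 0 < b) :
    gammaWeight b (1 / 2) = ((8 / (3 * √3 * √b) : ℝ) : ℂ) := by
  have h1 : Complex.Gamma (1 + 1 / 2) ^ 2 = ((Real.pi / 4 : ℝ) : ℂ) := by
    rw [add_comm, Complex.Gamma_add_one _ (by norm_num), Complex.Gamma_one_half_eq, mul_pow,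
      ← Complex.cpow_nat_mul]
    norm_num
    ring
  have h2 : Complex.Gamma (((5 / 6 : ℝ) : ℂ) + 1 / 2) = 1 / 3 * Complex.Gamma (1 / 3) := by
    rw [← Complex.Gamma_add_one _ (by norm_num)]
    norm_num
  have h3 : ((1 / 6 : ℝ) : ℂ) + 1 / 2 = 2 / 3 := by norm_num
  have h4 : (b : ℂ) ^ (-(1 / 2) : ℂ) = ((√b)⁻¹ : ℝ) := by
    rw [Real.sqrt_eq_rpow, ← Real.rpow_neg hb.le, Complex.ofReal_cpow hb.le]
    norm_num
  have h5 : gammaWeight b (1 / 2) = (b : ℂ) ^ (-(1 / 2) : ℂ) *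
      (1 / 3 * (Complex.Gamma (1 / 3) * Complex.Gamma (2 / 3))) /
        Complex.Gamma (1 + 1 / 2) ^ 2 := by
    rw [gammaWeight, h2, h3]
    ring
  rw [h5, h1, h4, Complex.Gamma_one_third_mul_Gamma_two_thirds]
  have hsb : √b ≠ 0 := (Real.sqrt_pos.mpr hb).ne'
  have : (8 / (3 * √3 * √b) : ℝ) =
      (√b)⁻¹ * (1 / 3 * (2 * Real.pi / √3)) / (Real.pi / 4) := by
    have := Real.pi_ne_zero
    field_simp
    norm_num
  rw [this]
  push_cast
  ring

/-- At poles of Γ(1/6+k) or Γ(5/6+k) the default values Γ = 0 and x/0 = 0 make both sides 0, which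
is the stated convention. -/
theorem mul_risingGamma_quotient (b : ℝ) (k : ℂ) :
    (b : ℂ) ^ k * (risingGamma 1 k ^ 2 / (risingGamma (1 / 6) k * risingGamma (5 / 6) k)) =
      2 * Real.pi * gammaSide b k := by
  rw [← Complex.Gamma_one_sixth_mul_Gamma_five_sixths, gammaSide, risingGamma, risingGamma,
    risingGamma, Complex.Gamma_one, div_one]
  simp only [div_eq_mul_inv, mul_inv, inv_inv]
  ring

theorem hasSum_ramanujanTerm {z : ℂ} {b c : ℝ} (hz : ‖z‖ ≤ 1 / 4) (hb : 0 < b)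
    (hrec : ∀ k, Admissible k → (1 / 6 + k) * (5 / 6 + k) * ∑' n, ramanujanTerm z (k + 1) n =
      b * (1 + k) ^ 2 * ∑' n, ramanujanTerm z k n)
    -- This is 4 · `gammaWeight b (1 / 2)` divided by Γ(1/6)Γ(5/6) = 2π.
    (hc : c = 16 / (3 * √3 * √b * Real.pi)) {k : ℂ} (hk : Admissible k) :
    HasSum (ramanujanTerm z k) (c * (b : ℂ) ^ k *
      (risingGamma 1 k ^ 2 / (risingGamma (1 / 6) k * risingGamma (5 / 6) k))) := by
  have hs := (summable_ramanujanTerm hk (hz.trans_lt (by norm_num))).hasSum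
  rw [tsum_ramanujanTerm_eq_gammaSide hz hb hrec hk, gammaWeight_half hb] at hs
  rw [mul_assoc, mul_risingGamma_quotient, ← mul_assoc]
  have : (4 : ℂ) * ((8 / (3 * √3 * √b) : ℝ) : ℂ) = c * (2 * Real.pi) := by
    rw [hc]
    norm_cast
    have := Real.pi_ne_zero
    have hsb : √b ≠ 0 := (Real.sqrt_pos.mpr hb).ne'
    field_simp
    norm_num
  rwa [this] at hs

theorem hasSum_ramanujanTerm_quarter {k : ℂ} (hk : Admissible k) :
    HasSum (ramanujanTerm (1 / 4) k) (4 / (Real.pi : ℂ) * (16 / 27 : ℂ) ^ k *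
      (risingGamma 1 k ^ 2 / (risingGamma (1 / 6) k * risingGamma (5 / 6) k))) := by
  have h : √(16 / 27 : ℝ) = 4 / (3 * √3) := by
    rw [Real.sqrt_eq_iff_mul_self_eq (by norm_num) (by positivity)]
    field_simp
    norm_num
  have := hasSum_ramanujanTerm (c := 4 / Real.pi) (by norm_num) (by norm_num)
    (fun _ => tsum_recurrence_quarter) (by rw [h]; field_simp; norm_num) hk
  push_cast at this
  exact this

theorem hasSum_ramanujanTerm_neg_eighth {k : ℂ} (hk : Admissible k) :
    HasSum (ramanujanTerm (-1 / 8) k) (2 * (Real.sqrt 2 : ℂ) / (Real.pi : ℂ) * (32 / 27 : ℂ) ^ k *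
      (risingGamma 1 k ^ 2 / (risingGamma (1 / 6) k * risingGamma (5 / 6) k))) := by
  have h : √(32 / 27 : ℝ) = 4 * √2 / (3 * √3) := by
    rw [Real.sqrt_eq_iff_mul_self_eq (by norm_num) (by positivity)]
    field_simp
    norm_num
  have := hasSum_ramanujanTerm (c := 2 * √2 / Real.pi) (by norm_num) (by norm_num)
    (fun _ => tsum_recurrence_neg_eighth) (by rw [h]; field_simp; norm_num) hk
  push_cast at this
  exact this

/-! ### The case k = 0 and the final statement -/

theorem ramanujanTerm_zero (z : ℝ) (n : ℕ) :
    ramanujanTerm z 0 n = ((z ^ n * ((ascPochhammer ℝ n).eval (1 / 2) ^ 3 /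
      (ascPochhammer ℝ n).eval 1 ^ 3) * (6 * n + 1) : ℝ) : ℂ) := by
  have h : ∀ x : ℝ, risingNat x n = ((ascPochhammer ℝ n).eval x : ℝ) := fun x => by
    rw [risingNat, ← ascPochhammer_map Complex.ofRealHom, Polynomial.eval_map,
      ← Complex.ofRealHom_eq_coe, Polynomial.eval₂_at_apply]
    rfl
  have h1 := h (1 / 2)
  have h2 := h 1
  push_cast at h1 h2
  simp only [ramanujanTerm, mul_zero, add_zero, sub_zero, h1, h2]
  push_cast
  ring

theorem admissible_zero : Admissible 0 := fun m h => by
  have : (m : ℂ) + 1 ≠ 0 := by exact_mod_cast m.succ_ne_zero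
  exact this (by linear_combination h)

theorem risingGamma_quotient_zero :
    risingGamma 1 0 ^ 2 / (risingGamma (1 / 6) 0 * risingGamma (5 / 6) 0) = 1 := by
  have h : ∀ x : ℂ, 0 < x.re → risingGamma x 0 = 1 := fun x hx => by
    rw [risingGamma, add_zero, div_self (Complex.Gamma_ne_zero_of_re_pos hx)]
  rw [h 1 (by norm_num), h (1 / 6) (by norm_num), h (5 / 6) (by norm_num)]
  norm_num

/-- In ℂ and ℝ unconditional summability is absolute convergence, so `HasSum` also gives the
convergence claim. -/
theorem mainTheorem10 :
    (∀ k : ℂ, (∀ m : ℕ, 2 * k ≠ -((m : ℂ) + 1)) →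
      HasSum (ramanujanTerm (1 / 4) k)
        (4 / (Real.pi : ℂ) * (16 / 27 : ℂ) ^ k *
          (risingGamma 1 k ^ 2 / (risingGamma (1 / 6) k * risingGamma (5 / 6) k))) ∧
      HasSum (ramanujanTerm (-1 / 8) k)
        (2 * (Real.sqrt 2 : ℂ) / (Real.pi : ℂ) * (32 / 27 : ℂ) ^ k *
          (risingGamma 1 k ^ 2 / (risingGamma (1 / 6) k * risingGamma (5 / 6) k)))) ∧
    HasSum (fun n : ℕ => (1 / 4 : ℝ) ^ n *
        ((ascPochhammer ℝ n).eval (1 / 2) ^ 3 / (ascPochhammer ℝ n).eval 1 ^ 3) * (6 * n + 1))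
      (4 / Real.pi) ∧
    HasSum (fun n : ℕ => (-1 / 8 : ℝ) ^ n *
        ((ascPochhammer ℝ n).eval (1 / 2) ^ 3 / (ascPochhammer ℝ n).eval 1 ^ 3) * (6 * n + 1))
      (2 * Real.sqrt 2 / Real.pi) := by
  refine ⟨fun k hk => ⟨hasSum_ramanujanTerm_quarter hk, hasSum_ramanujanTerm_neg_eighth hk⟩,
    ?_, ?_⟩
  · have h := hasSum_ramanujanTerm_quarter admissible_zero
    rw [risingGamma_quotient_zero, Complex.cpow_zero, mul_one, mul_one] at h
    rw [← Complex.hasSum_ofReal]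
    have hz : ((1 / 4 : ℝ) : ℂ) = 1 / 4 := by push_cast; rfl
    simp only [← ramanujanTerm_zero, hz]
    push_cast
    exact h
  · have h := hasSum_ramanujanTerm_neg_eighth admissible_zero
    rw [risingGamma_quotient_zero, Complex.cpow_zero, mul_one, mul_one] at h
    rw [← Complex.hasSum_ofReal]
    have hz : ((-1 / 8 : ℝ) : ℂ) = -1 / 8 := by push_cast; rfl
    simp only [← ramanujanTerm_zero, hz]
    push_cast
    exact h
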